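/- **Proposition (Leray sheaves of the Mayer–Vietoris blowup).** Let $X$ be a topological space, let $\mathcal U=(U_i)_{i\in I}$ be a finite open cover of $X$, and let $\mathbf R$ be a commutative ring; $H^n(-)=H^n(-;\mathbf R)$ denotes singular cohomology. *Conventions.* The nerve of a family $\mathcal W=(W_j)_{j\in J}$ of subsets of a space is the abstract simplicial complex $N_{\mathcal W}$ whose simplices are the finite nonempty $\sigma\subseteq J$ with nonempty support $W_\sigma=\bigcap_{j\in\sigma}W_j$. A cellular sheaf on a simplicial complex assigns functorially an $\mathbf R$-module to each simplex and a linear map to each face relation $\sigma\subseteq\tau$. The Čech cellular sheaf $\mathcal C^n$ of $\mathcal U$ on $N_{\mathcal U}$ is $\sigma\mapsto H^n(U_\sigma)$; the Leray cellular sheaf $\mathcal L^n$ of a continuous map $f:M\to Y$ and a family $\mathcal V$ covering $f(M)$ is the cellular sheaf $\sigma\mapsto H^n(f^{-1}(V_\sigma))$ on $N_{\mathcal V}$; all restriction maps are induced by inclusions. Let $|N_{\mathcal U}|\subset\mathbb R^I$ be the geometric realization of $N_{\mathcal U}$ in barycentric coordinates, let $|\sigma|$ and $\mathring\sigma$ be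 the closed and the open topological simplex of $\sigma$, and let $\mathrm{st}(\sigma)=\bigcup_{\tau\supseteq\sigma}\mathring\tau$ be its open star. The Mayer–Vietoris blowup is $$M_{\mathcal U}=\{(x,s)\in X\times|N_{\mathcal U}| : x\in U_\sigma \text{ and } s\in|\sigma| \text{ for some } \sigma\in N_{\mathcal U}\},$$ with projection $\rho_2:M_{\mathcal U}\to|N_{\mathcal U}|$, $(x,s)\mapsto s$. 1. *(Small neighborhoods of the simplices.)* Let $\mathcal V=(V_\sigma)_{\sigma\in N_{\mathcal U}}$ be open subsets of $|N_{\mathcal U}|$ such that $\mathring\sigma\subseteq V_\sigma\subseteq\mathrm{st}(\sigma)$, such that $V_\sigma\cap V_\tau=\emptyset$ unless one of $\sigma,\tau$ is a face of the other, and such that $V_\sigma\cap|\tau|$ is convex for all $\sigma,\tau\in N_{\mathcal U}$. Then the simplices of $N_{\mathcal V}$ are exactly the nonempty chains $\sigma_0\subsetneq\cdots\subsetneq\sigma_k$ of simplices of $N_{\mathcal U}$ (so $N_{\mathcal V}$ is the barycentric subdivision of $N_{\mathcal U}$), and for every $n\in\mathbb N$ the Leray cellular sheaf $\mathcal L^n$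 of $\rho_2$ and $\mathcal V$ is isomorphic, as a cellular sheaf on $N_{\mathcal V}$, to the subdivision of $\mathcal C^n$, i.e. to its pullback $(\sigma_0\subsetneq\cdots\subsetneq\sigma_k)\mapsto\mathcal C^n(\sigma_k)$ along the map $(\sigma_0\subsetneq\cdots\subsetneq\sigma_k)\mapsto\sigma_k$ of face posets. 2. *(Open stars.)* Let $\mathcal V$ be the family of open stars of the vertices, $V_i=\{s\in|N_{\mathcal U}| : s_i\neq 0\}$, $i\in I$. Then the support $V_\sigma$ of each $\sigma\in N_{\mathcal U}$ is $\mathrm{st}(\sigma)$, the nerve $N_{\mathcal V}$ equals $N_{\mathcal U}$, and for every $n\in\mathbb N$ the Leray cellular sheaf $\mathcal L^n$ of $\rho_2$ and $\mathcal V$ is isomorphic to $\mathcal C^n$ as a cellular sheaf on $N_{\mathcal U}$. -/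

import Mathlib

open CategoryTheory

universe u

noncomputable section

namespace MVBlowup

/-! ### Singular cohomology -/

/-- The dual `Hom_R(-, R)` of a chain complex of `R`-modules, as a contravariant functor. -/
def dualComplex (R : Type u) [CommRing R] :
    (ChainComplex (ModuleCat.{u} R) ℕ)ᵒᵖ ⥤
      HomologicalComplex (ModuleCat.{u} R) (ComplexShape.down ℕ).symm :=
  HomologicalComplex.opFunctor (ModuleCat.{u} R) (ComplexShape.down ℕ) ⋙
    ((linearYoneda R (ModuleCat.{u} R)).obj (ModuleCat.of R R)).mapHomologicalComplex _

/-- Singular cohomology `H^n(-; R)`: the cohomology of the `R`-dual of the singular chain complex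
with coefficients in `R`. -/
def singularCohomology (R : Type u) [CommRing R] (n : ℕ) : TopCat.{u}ᵒᵖ ⥤ ModuleCat.{u} R :=
  ((AlgebraicTopology.singularChainComplexFunctor (ModuleCat.{u} R)).obj (ModuleCat.of R R)).op ⋙
    dualComplex R ⋙ HomologicalComplex.homologyFunctor _ _ n

/-! ### Cellular sheaves on simplicial complexes, and nerves -/

/-- The simplices of a simplicial complex, ordered by the face relation. -/
abbrev Face {ι : Type u} (K : PreAbstractSimplicialComplex ι) : Type u := {σ : Finset ι // σ ∈ K}

/-- A cellular sheaf on a simplicial complex: an `R`-module for each simplex and a linear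
restriction map for each face relation `σ ≤ τ`, functorially. -/
abbrev CellularSheaf (R : Type u) [CommRing R] {ι : Type u} (K : PreAbstractSimplicialComplex ι) :=
  Face K ⥤ ModuleCat.{u} R

/-- The support `⋂_{i ∈ σ} U_i`. -/
def support {X ι : Type u} (U : ι → Set X) (σ : Finset ι) : Set X := {x | ∀ i ∈ σ, x ∈ U i}

lemma support_antitone {X ι : Type u} (U : ι → Set X) : Antitone (support U) :=
  fun _ _ h _ hx i hi => hx i (h hi)

/-- The nerve: finite nonempty collections of members with nonempty support. -/
def nerve {X ι : Type u} (U : ι → Set X) : PreAbstractSimplicialComplex ι where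
  faces := {σ | σ.Nonempty ∧ (support U σ).Nonempty}
  isRelLowerSet_faces := fun _ h =>
    ⟨h.1, fun _ hle hne => ⟨hne, h.2.mono (support_antitone U hle)⟩⟩

/-- A decreasing family of subspaces `A_p` of a space, as a diagram of spaces with the
inclusions `A_q ↪ A_p` for `p ≤ q`. -/
def subspaceFunctor {X P : Type u} [TopologicalSpace X] [Preorder P] (A : P → Set X)
    (hA : Antitone A) : P ⥤ TopCat.{u}ᵒᵖ where
  obj p := Opposite.op (TopCat.of (A p))
  map {p q} h := (TopCat.ofHom ⟨Set.inclusion (hA (leOfHom h)), continuous_inclusion _⟩ :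
      TopCat.of (A q) ⟶ TopCat.of (A p)).op
  map_id _ := rfl
  map_comp _ _ := rfl

/-- The Čech cellular sheaf `σ ↦ H^n(U_σ; R)` on the nerve of `U`. -/
def cechSheaf (R : Type u) [CommRing R] (n : ℕ) {X ι : Type u} [TopologicalSpace X]
    (U : ι → Set X) : CellularSheaf R (nerve U) :=
  subspaceFunctor (fun σ : Face (nerve U) => support U σ.1)
    (fun _ _ h => support_antitone U h) ⋙ singularCohomology R n

/-- The Leray cellular sheaf `σ ↦ H^n(f⁻¹(V_σ); R)` on the nerve of `V`. -/
def leraySheaf (R : Type u) [CommRing R] (n : ℕ) {X Y κ : Type u} [TopologicalSpace X]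
    (f : X → Y) (V : κ → Set Y) : CellularSheaf R (nerve V) :=
  subspaceFunctor (fun σ : Face (nerve V) => f ⁻¹' support V σ.1)
    (fun _ _ h => Set.preimage_mono (support_antitone V h)) ⋙ singularCohomology R n

/-! ### Geometric realization of a finite simplicial complex -/

open Classical in
/-- The indices of the nonzero coordinates. -/
def coordSupport {ι : Type u} [Fintype ι] (s : ι → ℝ) : Finset ι :=
  Finset.univ.filter (fun i => s i ≠ 0)

/-- The geometric realization, in barycentric coordinates, as a subspace of `ℝ^ι`. -/
def realization {ι : Type u} [Fintype ι] (K : PreAbstractSimplicialComplex ι) : Set (ι → ℝ) :=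
  {s | s ∈ stdSimplex ℝ ι ∧ coordSupport s ∈ K}

section

variable {ι : Type u} [Fintype ι] {K : PreAbstractSimplicialComplex ι}

/-- The closed topological simplex of `σ`. -/
def closedSimplex (σ : Face K) : Set (realization K) := {s | coordSupport s.1 ⊆ σ.1}

/-- The open topological simplex (relative interior of the closed simplex) of `σ`. -/
def openSimplex (σ : Face K) : Set (realization K) := {s | coordSupport s.1 = σ.1}

/-- The open star of `σ`: the union of the open simplices having `σ` as a face. -/
def openStar (σ : Face K) : Set (realization K) := {s | σ.1 ⊆ coordSupport s.1}

/-- The open star of the vertex `i` (empty if `i` is not a vertex of `K`). -/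
def vertexStar (K : PreAbstractSimplicialComplex ι) (i : ι) : Set (realization K) :=
  {s | i ∈ coordSupport s.1}

/-- A cover of the realization by small (convex) open neighborhoods of the topological simplices:
`V σ` is an open neighborhood of the open simplex of `σ`, lies in the open star of `σ`,
is disjoint from `V τ` unless one of `σ`, `τ` is a face of the other,
and meets each closed simplex in a convex set. -/
structure IsSmallSimplexCover (V : Face K → Set (realization K)) : Prop where
  isOpen : ∀ σ, IsOpen (V σ)
  openSimplex_subset : ∀ σ, openSimplex σ ⊆ V σ
  subset_openStar : ∀ σ, V σ ⊆ openStar σ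
  disjoint : ∀ σ τ, ¬ σ ≤ τ → ¬ τ ≤ σ → Disjoint (V σ) (V τ)
  convex : ∀ σ τ, Convex ℝ (Subtype.val '' (V σ ∩ closedSimplex τ))

open Classical in
/-- The simplex spanned by the vertices of all members of a set `S` of simplices
(when `S` is a nonempty chain, this is its largest member). -/
def carrierSimplex {V : Face K → Set (realization K)} (hV : IsSmallSimplexCover V)
    (S : Face (nerve V)) : Face K :=
  ⟨S.1.biUnion Subtype.val, by
    obtain ⟨S, ⟨σ, hσ⟩, s, hs⟩ := S
    refine (K.isRelLowerSet_faces s.2.2).2 (Finset.biUnion_subset.2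
      fun τ hτ => hV.subset_openStar τ (hs τ hτ)) ?_
    obtain ⟨i, hi⟩ := (K.isRelLowerSet_faces σ.2).1
    exact ⟨i, Finset.mem_biUnion.2 ⟨σ, hσ, hi⟩⟩⟩

/-- `carrierSimplex` as a map of face posets. -/
def carrierFunctor {V : Face K → Set (realization K)} (hV : IsSmallSimplexCover V) :
    Face (nerve V) ⥤ Face K :=
  Monotone.functor (f := carrierSimplex hV) (by
    classical
    intro S T h
    exact Finset.biUnion_subset_biUnion_of_subset_left Subtype.val h)

end

/-- The map of face posets given by the inclusion of a subcomplex. -/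
def faceInclusion {ι : Type u} {K L : PreAbstractSimplicialComplex ι} (h : K ≤ L) :
    Face K ⥤ Face L :=
  Monotone.functor (f := fun σ : Face K => (⟨σ.1, h σ.2⟩ : Face L)) (fun _ _ hle => hle)

/-! ### The Mayer–Vietoris blowup -/

/-- The Mayer–Vietoris blowup: pairs `(x, s)` such that `x ∈ U_σ` and `s ∈ σ` for some
simplex `σ` of the nerve. -/
def blowup {X ι : Type u} [Fintype ι] (U : ι → Set X) : Set (X × realization (nerve U)) :=
  {p | ∃ σ : Face (nerve U), p.1 ∈ support U σ.1 ∧ p.2 ∈ closedSimplex σ}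

/-- The projection of the blowup to the nerve. -/
def rho₂ {X ι : Type u} [Fintype ι] (U : ι → Set X) (p : blowup U) : realization (nerve U) :=
  p.1.2

end MVBlowup

end

noncomputable section

namespace MVBlowup

/-! ### Homotopy invariance of singular cohomology -/

/-! The fibre of the blowup over a point `s` is `U_τ`, where `τ` is the simplex whose open simplex
contains `s`. Suppose a support `V_S` lies in the open star of `F S` and is star-shaped about a
point `p` of the open simplex of `F S`. Contracting the second coordinate straight to `p` only
shrinks the carrier of `s`, so it stays in the blowup and retracts the preimage of `V_S` onto a copy
of `U_{F S}`. The maps `(x, s) ↦ x` commute with inclusions, hence give an isomorphism of sheaves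
(`nonempty_leraySheaf_iso`). It remains to find the centres `p`: for vertex stars a barycentre
works; for small neighborhoods, chains are handled by `exists_mem_support_of_isChain` and convexity
by `segmentPoint_mem_support`. -/

lemma singularCohomology_map_eq_of_homotopy (R : Type u) [CommRing R] (n : ℕ) {X Y : TopCat.{u}}
    {f g : X ⟶ Y} (H : TopCat.Homotopy f g) :
    (singularCohomology R n).map f.op = (singularCohomology R n).map g.op :=
  (((linearYoneda R (ModuleCat.{u} R)).obj (ModuleCat.of R R)).mapHomotopy
    (H.singularChainComplexFunctorObjMap (ModuleCat.of R R)).op).homologyMap_eq n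

lemma isIso_singularCohomology_map (R : Type u) [CommRing R] (n : ℕ) {X Y : TopCat.{u}}
    (f : X ⟶ Y) (g : Y ⟶ X) (H : TopCat.Homotopy (f ≫ g) (𝟙 X)) (hgf : g ≫ f = 𝟙 Y) :
    IsIso ((singularCohomology R n).map f.op) := by
  refine ⟨(singularCohomology R n).map g.op, ?_, ?_⟩
  · rw [← Functor.map_comp, ← op_comp, hgf, op_id, CategoryTheory.Functor.map_id]
  · rw [← Functor.map_comp, ← op_comp, singularCohomology_map_eq_of_homotopy R n H, op_id,
      CategoryTheory.Functor.map_id]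

/-! ### Points and segments in the geometric realization -/

section Realization

variable {ι : Type u} [Fintype ι] {K : PreAbstractSimplicialComplex ι}

lemma mem_coordSupport {s : ι → ℝ} {i : ι} : i ∈ coordSupport s ↔ s i ≠ 0 := by
  simp [coordSupport]

lemma coordSupport_nonempty {s : ι → ℝ} (hs : s ∈ stdSimplex ℝ ι) : (coordSupport s).Nonempty := by
  by_contra h
  have h0 : ∀ i, s i = 0 := fun i => by
    by_contra hi
    exact h ⟨i, mem_coordSupport.2 hi⟩
  simpa [h0] using hs.2

/-- The simplex whose open simplex contains a given point. -/
def pointFace (s : realization K) : Face K := ⟨coordSupport s.1, s.2.2⟩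

lemma exists_coordSupport_eq (σ : Face K) : ∃ p : realization K, coordSupport p.1 = σ.1 := by
  classical
  have hne : σ.1.Nonempty := (K.isRelLowerSet_faces σ.2).1
  have hc : (σ.1.card : ℝ) ≠ 0 := by exact_mod_cast hne.card_pos.ne'
  -- The barycentre of `σ`.
  set b : ι → ℝ := fun i => if i ∈ σ.1 then (σ.1.card : ℝ)⁻¹ else 0 with hb
  have hsupp : coordSupport b = σ.1 := by
    ext i
    simp [mem_coordSupport, hb, hne.ne_empty]
  refine ⟨⟨b, ⟨fun i => ?_, ?_⟩, by rw [hsupp]; exact σ.2⟩, hsupp⟩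
  · simp only [hb]
    split_ifs <;> positivity
  · simp [hb, hc]

/-- The point at time `t` on the segment from `s` to `p`, where `p` lies in the smallest closed
simplex containing `s`. -/
def segmentPoint (s p : realization K) (h : coordSupport p.1 ⊆ coordSupport s.1)
    (t : unitInterval) : realization K :=
  ⟨(1 - (t : ℝ)) • s.1 + (t : ℝ) • p.1, by
    have hmem : (1 - (t : ℝ)) • s.1 + (t : ℝ) • p.1 ∈ stdSimplex ℝ ι :=
      convex_stdSimplex ℝ ι s.2.1 p.2.1 (sub_nonneg.2 t.2.2) t.2.1 (by ring)
    refine ⟨hmem, (K.isRelLowerSet_faces s.2.2).2 (fun i hi => ?_) (coordSupport_nonempty hmem)⟩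
    rw [mem_coordSupport] at hi ⊢
    intro h0
    have hp : p.1 i = 0 := by
      by_contra hp
      exact mem_coordSupport.1 (h (mem_coordSupport.2 hp)) h0
    exact hi (by simp [h0, hp])⟩

variable {s p : realization K} (h : coordSupport p.1 ⊆ coordSupport s.1)

lemma coordSupport_segmentPoint_subset (t : unitInterval) :
    coordSupport (segmentPoint s p h t).1 ⊆ coordSupport s.1 := by
  intro i hi
  rw [mem_coordSupport] at hi ⊢
  intro h0
  have hp : p.1 i = 0 := by
    by_contra hp
    exact mem_coordSupport.1 (h (mem_coordSupport.2 hp)) h0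
  exact hi (by simp [segmentPoint, h0, hp])

/-- Before time 1 the coordinates of `s` keep positive weight, and nothing cancels since barycentric
coordinates are nonnegative. -/
lemma coordSupport_segmentPoint {t : unitInterval} (ht : (t : ℝ) < 1) :
    coordSupport (segmentPoint s p h t).1 = coordSupport s.1 := by
  refine (coordSupport_segmentPoint_subset h t).antisymm fun i hi => ?_
  rw [mem_coordSupport] at hi ⊢
  have h1 : 0 < (1 - (t : ℝ)) * s.1 i := mul_pos (sub_pos.2 ht) ((s.2.1.1 i).lt_of_ne' hi)
  have h2 : 0 ≤ (t : ℝ) * p.1 i := mul_nonneg t.2.1 (p.2.1.1 i)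
  exact (add_pos_of_pos_of_nonneg h1 h2).ne'

lemma segmentPoint_zero : segmentPoint s p h 0 = s := Subtype.ext (by simp [segmentPoint])

lemma segmentPoint_one : segmentPoint s p h 1 = p := Subtype.ext (by simp [segmentPoint])

lemma continuous_segmentPoint : Continuous (segmentPoint s p h) := by
  unfold segmentPoint
  fun_prop

lemma subset_coordSupport_segmentPoint (t : unitInterval) :
    coordSupport p.1 ⊆ coordSupport (segmentPoint s p h t).1 := by
  rcases t.2.2.lt_or_eq with ht | ht
  · rwa [coordSupport_segmentPoint h ht]
  · rw [show t = 1 from Subtype.ext ht, segmentPoint_one]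

/-- The open simplex of `σ` is dense in the closed one. -/
lemma exists_mem_coordSupport_eq {W : Set (realization K)} (hW : IsOpen W) {p : realization K}
    (hp : p ∈ W) (σ : Face K) (hσ : coordSupport p.1 ⊆ σ.1) :
    ∃ q ∈ W, coordSupport q.1 = σ.1 := by
  obtain ⟨b, hb⟩ := exists_coordSupport_eq σ
  have h : coordSupport p.1 ⊆ coordSupport b.1 := hb ▸ hσ
  -- Travel from the barycentre-type point `b` towards `p` and stop just before arrival: already in
  -- `W`, still in the open simplex of `σ`.
  have hnhds : segmentPoint b p h ⁻¹' W ∈ nhds (1 : unitInterval) :=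
    (hW.preimage (continuous_segmentPoint h)).mem_nhds (by
      rwa [Set.mem_preimage, segmentPoint_one])
  have hne : (nhdsWithin (1 : unitInterval) (Set.Iio 1)).NeBot :=
    nhdsLT_neBot_of_exists_lt ⟨0, zero_lt_one⟩
  obtain ⟨t, htW, ht⟩ := hne.nonempty_of_mem
    (Filter.inter_mem (mem_nhdsWithin_of_mem_nhds hnhds) self_mem_nhdsWithin)
  exact ⟨_, htW, (coordSupport_segmentPoint h ht).trans hb⟩

end Realization

/-! ### Leray sheaves of the blowup for star-shaped supports -/

section Leray

lemma mem_support_of_mem_blowup {X ι : Type u} [Fintype ι] (U : ι → Set X)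
    {y : X × realization (nerve U)} (hy : y ∈ blowup U) :
    y.1 ∈ support U (coordSupport y.2.1) := by
  obtain ⟨τ, hx, hs⟩ := hy
  exact support_antitone U hs hx

variable {X ι κ : Type u} [TopologicalSpace X] [Fintype ι] (U : ι → Set X)
  (V : κ → Set (realization (nerve U))) (F : Face (nerve V) ⥤ Face (nerve U))

/-- The projection `(x, s) ↦ x` from the preimage of the supports of `V` to the supports of `U`. -/
def projection
    (hF : ∀ S : Face (nerve V), ∀ s ∈ support V S.1, (F.obj S).1 ⊆ coordSupport s.1) :
    F ⋙ subspaceFunctor (fun σ : Face (nerve U) => support U σ.1)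
        (fun _ _ h => support_antitone U h) ⟶
      subspaceFunctor (fun S : Face (nerve V) => rho₂ U ⁻¹' support V S.1)
        (fun _ _ h => Set.preimage_mono (support_antitone V h)) where
  app S := (TopCat.ofHom ⟨fun y => ⟨y.1.1.1,
      support_antitone U (hF S y.1.1.2 y.2) (mem_support_of_mem_blowup U y.1.2)⟩, by fun_prop⟩ :
    TopCat.of (rho₂ U ⁻¹' support V S.1) ⟶ TopCat.of (support U (F.obj S).1)).op
  naturality _ _ _ := rfl

lemma isIso_singularCohomology_map_projection (R : Type u) [CommRing R] (n : ℕ)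
    (hF : ∀ S : Face (nerve V), ∀ s ∈ support V S.1, (F.obj S).1 ⊆ coordSupport s.1)
    (S : Face (nerve V)) (p : realization (nerve U)) (hp : coordSupport p.1 = (F.obj S).1)
    (hseg : ∀ s ∈ support V S.1, ∀ h : coordSupport p.1 ⊆ coordSupport s.1, ∀ t : unitInterval,
      segmentPoint s p h t ∈ support V S.1) :
    IsIso ((singularCohomology R n).map ((projection U V F hF).app S)) := by
  have hsub : ∀ s ∈ support V S.1, coordSupport p.1 ⊆ coordSupport s.1 := fun s hs =>
    hp ▸ hF S s hs
  have hpS : p ∈ support V S.1 := by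
    obtain ⟨s, hs⟩ := S.2.2
    simpa only [segmentPoint_one] using hseg s hs (hsub s hs) 1
  let g : TopCat.of (support U (F.obj S).1) ⟶ TopCat.of (rho₂ U ⁻¹' support V S.1) :=
    TopCat.ofHom ⟨fun x => ⟨⟨(x.1, p), F.obj S, x.2, hp.subset⟩, hpS⟩, by fun_prop⟩
  -- The first coordinate is fixed. The carrier of the starting point witnesses membership in the
  -- blowup at all times.
  let H : C(unitInterval × (rho₂ U ⁻¹' support V S.1), rho₂ U ⁻¹' support V S.1) :=
    ⟨fun z => ⟨⟨(z.2.1.1.1, segmentPoint z.2.1.1.2 p (hsub z.2.1.1.2 z.2.2) z.1),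
        pointFace z.2.1.1.2, mem_support_of_mem_blowup U z.2.1.2,
        coordSupport_segmentPoint_subset (hsub z.2.1.1.2 z.2.2) z.1⟩,
        hseg z.2.1.1.2 z.2.2 (hsub z.2.1.1.2 z.2.2) z.1⟩, by
      unfold segmentPoint
      fun_prop⟩
  refine isIso_singularCohomology_map R n ((projection U V F hF).app S).unop g
    (ContinuousMap.Homotopy.symm ⟨H, fun y => ?_, fun y => ?_⟩) rfl
  · exact Subtype.ext (Subtype.ext (Prod.ext rfl (segmentPoint_zero (hsub y.1.1.2 y.2))))
  · exact Subtype.ext (Subtype.ext (Prod.ext rfl (segmentPoint_one (hsub y.1.1.2 y.2))))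

/-- If each support `V_S` lies in the open star of a simplex `F S` and is star-shaped about a
point of the open simplex of `F S`, then the Leray sheaf is the pullback of the Čech sheaf
along `F`. -/
theorem nonempty_leraySheaf_iso (R : Type u) [CommRing R] (n : ℕ)
    (hF : ∀ S : Face (nerve V), ∀ s ∈ support V S.1, (F.obj S).1 ⊆ coordSupport s.1)
    (hseg : ∀ S : Face (nerve V), ∃ p : realization (nerve U), coordSupport p.1 = (F.obj S).1 ∧
      ∀ s ∈ support V S.1, ∀ h : coordSupport p.1 ⊆ coordSupport s.1, ∀ t : unitInterval,
        segmentPoint s p h t ∈ support V S.1) :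
    Nonempty (leraySheaf R n (rho₂ U) V ≅ F ⋙ cechSheaf R n U) := by
  let α := Functor.whiskerRight (projection U V F hF) (singularCohomology R n)
  have : ∀ S, IsIso (α.app S) := fun S => by
    obtain ⟨p, hp, hs⟩ := hseg S
    exact isIso_singularCohomology_map_projection U V F R n hF S p hp hs
  have : IsIso α := NatIso.isIso_of_isIso_app α
  exact ⟨(asIso α).symm⟩

end Leray

/-! ### Small neighborhoods of the simplices -/

section SmallCover

variable {ι : Type u} [Fintype ι] {K : PreAbstractSimplicialComplex ι}
  {V : Face K → Set (realization K)}

lemma isOpen_support {Y κ : Type u} [TopologicalSpace Y] {W : κ → Set Y} (hW : ∀ j, IsOpen (W j))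
    (S : Finset κ) : IsOpen (support W S) := by
  have : support W S = ⋂ j ∈ S, W j := by
    ext
    simp [support]
  rw [this]
  exact isOpen_biInter_finset fun j _ => hW j

open Classical in
-- Induction removing the largest member `m`: a common point of the other neighborhoods lies in the
-- closed simplex of `m`, and since their intersection is open it can be moved into the open simplex
-- of `m`, which `V m` contains.
lemma exists_mem_support_of_isChain (hV : IsSmallSimplexCover V) (S : Finset (Face K))
    (hne : S.Nonempty) (hS : IsChain (· ≤ ·) (S : Set (Face K))) :
    ∃ p ∈ support V S, coordSupport p.1 = S.biUnion Subtype.val := by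
  induction hn : S.card generalizing S with
  | zero => exact absurd (Finset.card_eq_zero.1 hn) hne.ne_empty
  | succ k ih =>
    obtain ⟨m, hm⟩ := S.exists_maximal hne
    have hle : ∀ σ ∈ S, σ ≤ m := fun σ hσ =>
      (hS.total hσ hm.1).elim id fun h => hm.2 hσ h
    have hbm : S.biUnion Subtype.val = m.1 :=
      (Finset.biUnion_subset.2 hle).antisymm (Finset.subset_biUnion_of_mem Subtype.val hm.1)
    obtain ⟨p, hp, hpm⟩ : ∃ p ∈ support V (S.erase m), coordSupport p.1 ⊆ m.1 := by
      rcases (S.erase m).eq_empty_or_nonempty with he | hne'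
      · obtain ⟨p, hp⟩ := exists_coordSupport_eq m
        -- The support of the empty family is the whole realization.
        exact ⟨p, by simp [he, support], hp.subset⟩
      · obtain ⟨p, hp, hpe⟩ := ih (S.erase m) hne'
          (hS.mono (by exact_mod_cast S.erase_subset m))
          (by rw [Finset.card_erase_of_mem hm.1, hn]; rfl)
        refine ⟨p, hp, ?_⟩
        rw [hpe, ← hbm]
        exact Finset.biUnion_subset_biUnion_of_subset_left _ (S.erase_subset m)
    obtain ⟨q, hq, hqm⟩ := exists_mem_coordSupport_eq (isOpen_support hV.isOpen _) hp m hpm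
    refine ⟨q, fun σ hσ => ?_, hqm.trans hbm.symm⟩
    by_cases h : σ = m
    · exact h ▸ hV.openSimplex_subset m hqm
    · exact hq σ (Finset.mem_erase.2 ⟨h, hσ⟩)

lemma mem_nerve_iff_isChain (hV : IsSmallSimplexCover V) (S : Finset (Face K)) :
    S ∈ nerve V ↔ S.Nonempty ∧ IsChain (· ≤ ·) (S : Set (Face K)) := by
  refine ⟨fun h => ⟨h.1, fun σ hσ τ hτ _ => ?_⟩, fun h => ⟨h.1, ?_⟩⟩
  · obtain ⟨s, hs⟩ := h.2
    by_contra hn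
    rw [not_or] at hn
    exact Set.disjoint_left.1 (hV.disjoint σ τ hn.1 hn.2) (hs σ hσ) (hs τ hτ)
  · obtain ⟨p, hp, _⟩ := exists_mem_support_of_isChain hV S h.1 h.2
    exact ⟨p, hp⟩

lemma segmentPoint_mem_support (hV : IsSmallSimplexCover V) (S : Finset (Face K))
    {s p : realization K} (hs : s ∈ support V S) (hp : p ∈ support V S)
    (h : coordSupport p.1 ⊆ coordSupport s.1) (t : unitInterval) :
    segmentPoint s p h t ∈ support V S := by
  intro σ hσ
  -- Convexity is available only inside one closed simplex; that of the carrier of `s` contains both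
  -- endpoints.
  obtain ⟨r, hr, he⟩ := hV.convex σ (pointFace s) ⟨s, ⟨hs σ hσ, Finset.Subset.refl _⟩, rfl⟩
    ⟨p, ⟨hp σ hσ, h⟩, rfl⟩ (sub_nonneg.2 t.2.2) t.2.1 (by ring)
  rw [show segmentPoint s p h t = r from Subtype.ext he.symm]
  exact hr.1

end SmallCover

/-! ### Open stars of the vertices -/

section OpenStars

variable {ι : Type u} [Fintype ι] {K : PreAbstractSimplicialComplex ι}

lemma nerve_vertexStar : nerve (vertexStar K) = K := by
  ext σ
  refine ⟨fun ⟨hne, s, hs⟩ => (K.isRelLowerSet_faces s.2.2).2 hs hne, fun hσ => ?_⟩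
  obtain ⟨p, hp⟩ := exists_coordSupport_eq (⟨σ, hσ⟩ : Face K)
  exact ⟨(K.isRelLowerSet_faces hσ).1, p, hp.superset⟩

end OpenStars

end MVBlowup

end

theorem mainTheorem6 {X : Type u} [TopologicalSpace X] {ι : Type u} [Fintype ι]
    (U : ι → Set X) (hUo : ∀ i, IsOpen (U i)) (hUc : ⋃ i, U i = Set.univ)
    (R : Type u) [CommRing R] :
    -- arbitrary covers of the nerve by small neighborhoods of its simplices
    (∀ (V : MVBlowup.Face (MVBlowup.nerve U) →
          Set (MVBlowup.realization (MVBlowup.nerve U)))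
        (hV : MVBlowup.IsSmallSimplexCover V),
        (∀ S : Finset (MVBlowup.Face (MVBlowup.nerve U)),
          S ∈ MVBlowup.nerve V ↔ S.Nonempty ∧ IsChain (· ≤ ·)
            (S : Set (MVBlowup.Face (MVBlowup.nerve U)))) ∧
        ∀ n : ℕ, Nonempty
          (MVBlowup.leraySheaf R n (MVBlowup.rho₂ U) V ≅
            MVBlowup.carrierFunctor hV ⋙ MVBlowup.cechSheaf R n U)) ∧
    -- the cover by open stars of vertices, in which each simplex has its open star as support
    ((∀ σ : MVBlowup.Face (MVBlowup.nerve U),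
        MVBlowup.support (MVBlowup.vertexStar (MVBlowup.nerve U)) σ.1 = MVBlowup.openStar σ) ∧
      ∃ h : MVBlowup.nerve (MVBlowup.vertexStar (MVBlowup.nerve U)) = MVBlowup.nerve U,
        ∀ n : ℕ, Nonempty
          (MVBlowup.leraySheaf R n (MVBlowup.rho₂ U)
              (MVBlowup.vertexStar (MVBlowup.nerve U)) ≅
            MVBlowup.faceInclusion h.le ⋙ MVBlowup.cechSheaf R n U)) := by
  classical
  refine ⟨fun V hV => ⟨MVBlowup.mem_nerve_iff_isChain hV, fun n =>
    MVBlowup.nonempty_leraySheaf_iso U V _ R n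
      (fun S s hs => Finset.biUnion_subset.2 fun τ hτ => hV.subset_openStar τ (hs τ hτ))
      fun S => ?_⟩,
    fun _ => rfl, MVBlowup.nerve_vertexStar, fun n =>
    MVBlowup.nonempty_leraySheaf_iso U _ _ R n (fun _ _ hs => hs) fun S => ?_⟩
  · have hS := (MVBlowup.mem_nerve_iff_isChain hV S.1).1 S.2
    obtain ⟨p, hpS, hp⟩ := MVBlowup.exists_mem_support_of_isChain hV S.1 hS.1 hS.2
    exact ⟨p, hp, fun s hs h t => MVBlowup.segmentPoint_mem_support hV S.1 hs hpS h t⟩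
  · obtain ⟨p, hp⟩ := MVBlowup.exists_coordSupport_eq
      (⟨S.1, MVBlowup.nerve_vertexStar.le S.2⟩ : MVBlowup.Face (MVBlowup.nerve U))
    -- Coordinates indexed by the simplex are nonzero at `p`, hence all along the segment, so the
    -- open star is star-shaped about `p`.
    exact ⟨p, hp, fun s _ h t =>
      hp.superset.trans (MVBlowup.subset_coordSupport_segmentPoint h t)⟩
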